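/- \textbf{Theorem 1 (Sample kurtosis).} Let $y_1, y_2, \dots$ be i.i.d. real random variables and, for $n \ge 1$, put $\bar y = \frac1n\sum_{i=1}^n y_i$ and $$Z_n = \frac{\frac1n\sum_{i=1}^n (y_i-\bar y)^4}{\left(\frac1n\sum_{i=1}^n (y_i-\bar y)^2\right)^2}.$$ For $\varphi>0$ and $\nu>0$ let $t(0,\varphi,\nu)$ be the Student distribution with $\nu$ degrees of freedom, centre $0$ and squared scale $\varphi$, that is, the distribution on $\mathbb R$ with density $$x \mapsto \frac{\Gamma(\frac{\nu+1}{2})}{\Gamma(\frac{\nu}{2})\sqrt{\nu\pi\varphi}}\left(1+\frac{x^2}{\nu\varphi}\right)^{-(\nu+1)/2};$$ its variance is finite exactly when $\nu>2$. (i) If $y_i \sim N(0,\varphi_N)$ (mean $0$ and variance $\varphi_N$) with $\varphi_N>0$, then $\sqrt n\,(Z_n-3)$ converges in distribution to $N(0,24)$ as $n\to\infty$. (ii) If $y_i \sim t(0,\varphi_T,\nu)$ with $\varphi_T>0$ and $2<\nu<\infty$, then $\sqrt n\,(Z_n-3)$ diverges as $n\to\infty$: it tends to $+\infty$ almost surely.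 If moreover $\nu>4$, then $Z_n \to \frac{3(\nu-2)}{\nu-4}$ almost surely. (iii) Case (i) is the limit $\nu\to\infty$ of case (ii): for every $\varphi>0$, $t(0,\varphi,\nu)$ converges weakly to $N(0,\varphi)$ as $\nu\to\infty$. -/

import Mathlib

open MeasureTheory ProbabilityTheory Filter Topology
open scoped NNReal ENNReal BoundedContinuousFunction

noncomputable section

/-- The mean of the first `n` terms of a sequence of observations. -/
def sampleMean (n : ℕ) (y : ℕ → ℝ) : ℝ :=
  (1 / (n : ℝ)) * ∑ i ∈ Finset.range n, y i

/-- The `k`-th central sample moment of the first `n` terms of a sequence of observations. -/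
def centralSampleMoment (k n : ℕ) (y : ℕ → ℝ) : ℝ :=
  (1 / (n : ℝ)) * ∑ i ∈ Finset.range n, (y i - sampleMean n y) ^ k

/-- The sample kurtosis of the first `n` terms of a sequence of observations. -/
def sampleKurtosis (n : ℕ) (y : ℕ → ℝ) : ℝ :=
  centralSampleMoment 4 n y / (centralSampleMoment 2 n y) ^ 2

/-- The density of the Student distribution `t(0, φ, ν)` centred at `0`, with squared scale `φ`
and `ν` degrees of freedom (its variance is `φ * ν / (ν - 2)` when `2 < ν`). -/
def studentTPDF (φ : ℝ≥0) (ν x : ℝ) : ℝ :=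
  Real.Gamma ((ν + 1) / 2) / (Real.Gamma (ν / 2) * √(ν * Real.pi * φ)) *
    (1 + x ^ 2 / (ν * φ)) ^ (-((ν + 1) / 2))

/-- The Student distribution `t(0, φ, ν)`, for `0 < φ` and `0 < ν`. -/
def studentT (φ : ℝ≥0) (ν : ℝ) : Measure ℝ :=
  volume.withDensity (fun x ↦ ENNReal.ofReal (studentTPDF φ ν x))

end

/-!
Sample kurtosis is invariant under affine maps of the data, so one may standardize. For standardized
data, expanding the central sample moments `m₄` and `m₂` around `𝔼 x⁴ = κ` and `1` shows that
`√n (m₄ / m₂² - κ)` is, up to a term that tends to `0` in probability, the normalized sum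
of the influence function `x⁴ - 4 γ x - 2 κ (x² - 1) - κ`, where `γ` is the skewness. The central
limit theorem and Slutsky's lemma give a Gaussian limit for `Z_n` under eight moments. At a Gaussian
law the influence function is the Hermite polynomial `x⁴ - 6 x² + 3`, whose variance is `4! = 24` by
iterating Stein's identity.

A Student law has kurtosis larger than `3`, or an infinite fourth moment; in both cases the strong
law of large numbers keeps `Z_n - 3` bounded away from `0`, and the factor `√n` diverges. As `ν → ∞`
the Student density converges pointwise, by the asymptotics of `Γ(x + 1/2) / Γ(x)`, and it is
dominated by a multiple of `1 / (1 + x² / (2 φ))`.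
-/

section SampleMoments

theorem sampleMean_eq_div (n : ℕ) (y : ℕ → ℝ) :
    sampleMean n y = (∑ i ∈ Finset.range n, y i) / n :=
  one_div_mul_eq_div _ _

@[simp]
theorem sampleMean_zero (y : ℕ → ℝ) : sampleMean 0 y = 0 := by simp [sampleMean]

theorem sampleMean_const {n : ℕ} (hn : n ≠ 0) (a : ℝ) : sampleMean n (fun _ ↦ a) = a := by
  simp [sampleMean, hn]

theorem sampleMean_add (n : ℕ) (x y : ℕ → ℝ) :
    sampleMean n (fun i ↦ x i + y i) = sampleMean n x + sampleMean n y := by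
  simp only [sampleMean, Finset.sum_add_distrib, mul_add]

theorem sampleMean_sub (n : ℕ) (x y : ℕ → ℝ) :
    sampleMean n (fun i ↦ x i - y i) = sampleMean n x - sampleMean n y := by
  simp only [sampleMean, Finset.sum_sub_distrib, mul_sub]

theorem sampleMean_const_mul (n : ℕ) (a : ℝ) (y : ℕ → ℝ) :
    sampleMean n (fun i ↦ a * y i) = a * sampleMean n y := by
  simp only [sampleMean, ← Finset.mul_sum, mul_left_comm]

theorem sampleMean_div_const (n : ℕ) (y : ℕ → ℝ) (a : ℝ) :
    sampleMean n (fun i ↦ y i / a) = sampleMean n y / a := by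
  simp only [sampleMean, ← Finset.sum_div, mul_div_assoc]

theorem sampleMean_mono (n : ℕ) {x y : ℕ → ℝ} (h : ∀ i, x i ≤ y i) :
    sampleMean n x ≤ sampleMean n y :=
  mul_le_mul_of_nonneg_left (Finset.sum_le_sum fun i _ ↦ h i) (by positivity)

@[simp]
theorem centralSampleMoment_zero_right (k : ℕ) (y : ℕ → ℝ) : centralSampleMoment k 0 y = 0 := by
  simp [centralSampleMoment]

theorem centralSampleMoment_eq_sum (k n : ℕ) (y : ℕ → ℝ) :
    centralSampleMoment k n y = ∑ j ∈ Finset.range (k + 1),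
      sampleMean n (fun i ↦ y i ^ j) * (-sampleMean n y) ^ (k - j) * k.choose j := by
  simp only [centralSampleMoment, sub_eq_add_neg, add_pow]
  rw [Finset.sum_comm]
  simp only [sampleMean, Finset.mul_sum, Finset.sum_mul]
  simp only [mul_assoc]

theorem centralSampleMoment_two (n : ℕ) (y : ℕ → ℝ) :
    centralSampleMoment 2 n y = sampleMean n (fun i ↦ y i ^ 2) - sampleMean n y ^ 2 := by
  rcases eq_or_ne n 0 with rfl | hn
  · simp
  simp only [centralSampleMoment_eq_sum, Finset.sum_range_succ, Finset.sum_range_zero, pow_zero,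
    pow_one, sampleMean_const hn]
  norm_num [Nat.choose]
  ring

theorem centralSampleMoment_four (n : ℕ) (y : ℕ → ℝ) :
    centralSampleMoment 4 n y = sampleMean n (fun i ↦ y i ^ 4)
      - 4 * sampleMean n y * sampleMean n (fun i ↦ y i ^ 3)
      + 6 * sampleMean n y ^ 2 * sampleMean n (fun i ↦ y i ^ 2) - 3 * sampleMean n y ^ 4 := by
  rcases eq_or_ne n 0 with rfl | hn
  · simp
  simp only [centralSampleMoment_eq_sum, Finset.sum_range_succ, Finset.sum_range_zero, pow_zero,
    pow_one, sampleMean_const hn]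
  norm_num [Nat.choose]
  ring

theorem sampleMean_pow_div_sub_le_centralSampleMoment {k : ℕ} (hk : Even k) (n : ℕ) (y : ℕ → ℝ) :
    sampleMean n (fun i ↦ y i ^ k) / 2 ^ (k - 1) - sampleMean n y ^ k ≤
      centralSampleMoment k n y := by
  rcases eq_or_ne n 0 with rfl | hn
  · simp
  rw [← sampleMean_const hn (sampleMean n y ^ k), ← sampleMean_div_const, ← sampleMean_sub]
  refine sampleMean_mono n fun i ↦ ?_
  have h := hk.add_pow_le (a := y i - sampleMean n y) (b := sampleMean n y)
  rw [sub_add_cancel] at h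
  rw [sub_le_iff_le_add, div_le_iff₀' (by positivity)]
  exact h

theorem sampleMean_sub_div {n : ℕ} (hn : n ≠ 0) (a b : ℝ) (y : ℕ → ℝ) :
    sampleMean n (fun i ↦ (y i - a) / b) = (sampleMean n y - a) / b := by
  rw [sampleMean_div_const, sampleMean_sub, sampleMean_const hn]

theorem centralSampleMoment_sub_div (k n : ℕ) (a b : ℝ) (y : ℕ → ℝ) :
    centralSampleMoment k n (fun i ↦ (y i - a) / b) = centralSampleMoment k n y / b ^ k := by
  rcases eq_or_ne n 0 with rfl | hn
  · simp
  simp only [centralSampleMoment, sampleMean_sub_div hn, ← sub_div, sub_sub_sub_cancel_right,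
    div_pow, ← Finset.sum_div, mul_div_assoc]

theorem sampleKurtosis_sub_div (n : ℕ) (a : ℝ) {b : ℝ} (hb : b ≠ 0) (y : ℕ → ℝ) :
    sampleKurtosis n (fun i ↦ (y i - a) / b) = sampleKurtosis n y := by
  rw [sampleKurtosis, sampleKurtosis, centralSampleMoment_sub_div, centralSampleMoment_sub_div,
    div_pow, ← pow_mul, div_div_div_cancel_right₀ (pow_ne_zero _ hb)]

end SampleMoments

section ConvergenceInDistribution

variable {Ω Ω' : Type*} [MeasurableSpace Ω] [MeasurableSpace Ω'] {P : Measure Ω}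
  [IsProbabilityMeasure P] {P' : Measure Ω'} [IsProbabilityMeasure P']

theorem tendstoInMeasure_of_tendstoInDistribution_const {ι E : Type*} [PseudoEMetricSpace E]
    [MeasurableSpace E] [OpensMeasurableSpace E] {l : Filter ι} {X : ι → Ω → E} {c : E}
    (h : TendstoInDistribution X l (fun _ : Ω' ↦ c) (fun _ ↦ P) P') :
    TendstoInMeasure P X l (fun _ ↦ c) := by
  intro ε hε
  have hclosed : IsClosed {x : E | ε ≤ edist x c} :=
    isClosed_le continuous_const (continuous_id.edist continuous_const)
  have hmap (i : ι) : (P.map (X i)) {x : E | ε ≤ edist x c} = P {ω | ε ≤ edist (X i ω) c} :=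
    Measure.map_apply_of_aemeasurable (h.forall_aemeasurable i) hclosed.measurableSet
  have hzero : (P'.map fun _ : Ω' ↦ c) {x : E | ε ≤ edist x c} = 0 := by
    rw [Measure.map_apply measurable_const hclosed.measurableSet]
    simp [hε.not_ge]
  have hlim := ProbabilityMeasure.limsup_measure_closed_le_of_tendsto h.tendsto hclosed
  simp only [ProbabilityMeasure.coe_mk, hmap, hzero] at hlim
  exact tendsto_of_le_liminf_of_limsup_le bot_le hlim

variable {X : ℕ → Ω → ℝ} {Z : Ω' → ℝ}

theorem tendstoInMeasure_mul_zero {B : ℕ → Ω → ℝ}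
    (hX : TendstoInDistribution X atTop Z (fun _ ↦ P) P') (hB : ∀ n, AEMeasurable (B n) P)
    (hB0 : ∀ᵐ ω ∂P, Tendsto (B · ω) atTop (𝓝 0)) :
    TendstoInMeasure P (fun n ω ↦ X n ω * B n ω) atTop (fun _ ↦ 0) := by
  have h := hX.continuous_comp_prodMk_of_tendstoInMeasure_const continuous_mul
    (tendstoInMeasure_of_tendsto_ae (fun n ↦ (hB n).aestronglyMeasurable) hB0) hB
  simp only [mul_zero] at h
  exact tendstoInMeasure_of_tendstoInDistribution_const h

theorem tendstoInDistribution_div_const {D : ℕ → Ω → ℝ} {d : ℝ}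
    (hX : TendstoInDistribution X atTop Z (fun _ ↦ P) P') (hD : ∀ n, AEMeasurable (D n) P)
    (hDd : ∀ᵐ ω ∂P, Tendsto (D · ω) atTop (𝓝 d)) (hd : d ≠ 0) :
    TendstoInDistribution (fun n ω ↦ X n ω / D n ω) atTop (fun ω ↦ Z ω / d) (fun _ ↦ P) P' := by
  have hinv : TendstoInMeasure P (fun n ω ↦ (D n ω)⁻¹) atTop fun _ ↦ d⁻¹ :=
    tendstoInMeasure_of_tendsto_ae (fun n ↦ (hD n).inv.aestronglyMeasurable)
      (hDd.mono fun ω hω ↦ hω.inv₀ hd)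
  simp only [div_eq_mul_inv]
  exact hX.continuous_comp_prodMk_of_tendstoInMeasure_const continuous_mul hinv
    fun n ↦ (hD n).inv

theorem tendstoInDistribution_of_ae_eventuallyEq {Y : ℕ → Ω → ℝ}
    (hX : TendstoInDistribution X atTop Z (fun _ ↦ P) P') (hY : ∀ n, AEMeasurable (Y n) P)
    (hXY : ∀ᵐ ω ∂P, (X · ω) =ᶠ[atTop] (Y · ω)) :
    TendstoInDistribution Y atTop Z (fun _ ↦ P) P' := by
  refine tendstoInDistribution_of_tendstoInMeasure_sub Y Z hX ?_ hY
  refine tendstoInMeasure_of_tendsto_ae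
    (fun n ↦ ((hY n).sub (hX.forall_aemeasurable n)).aestronglyMeasurable) ?_
  filter_upwards [hXY] with ω hω
  refine tendsto_const_nhds.congr' ?_
  filter_upwards [hω] with n hn
  simp [hn]

end ConvergenceInDistribution

section IndependentIdenticallyDistributed

variable {Ω : Type*} [MeasurableSpace Ω] {P : Measure Ω} {X : ℕ → Ω → ℝ}

theorem tendsto_sampleMean_ae (hint : Integrable (X 0) P)
    (hindep : Pairwise (Function.onFun (· ⟂ᵢ[P] ·) X))
    (hident : ∀ i, IdentDistrib (X i) (X 0) P P) :
    ∀ᵐ ω ∂P, Tendsto (fun n ↦ sampleMean n (X · ω)) atTop (𝓝 P[X 0]) := by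
  simp only [sampleMean_eq_div]
  exact strong_law_ae_real X hint hindep hident

theorem integrable_min_const [IsFiniteMeasure P] {f : Ω → ℝ} (hf : AEMeasurable f P)
    (hf0 : 0 ≤ᵐ[P] f) (c : ℝ) : Integrable (fun ω ↦ min (f ω) c) P := by
  refine Integrable.of_bound (hf.min aemeasurable_const).aestronglyMeasurable |c| ?_
  filter_upwards [hf0] with ω hω
  exact abs_le.2 ⟨le_min ((neg_nonpos.2 (abs_nonneg c)).trans hω) (neg_abs_le c),
    (min_le_right _ _).trans (le_abs_self c)⟩

theorem tendsto_integral_min_natCast_atTop [IsFiniteMeasure P] {f : Ω → ℝ}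
    (hf : AEMeasurable f P) (hf0 : 0 ≤ᵐ[P] f) (hfi : ¬ Integrable f P) :
    Tendsto (fun K : ℕ ↦ ∫ ω, min (f ω) K ∂P) atTop atTop := by
  have hmin0 (K : ℕ) : 0 ≤ᵐ[P] fun ω ↦ min (f ω) K :=
    hf0.mono fun ω hω ↦ le_min hω K.cast_nonneg
  have htop : ∫⁻ ω, ENNReal.ofReal (f ω) ∂P = ∞ := by
    by_contra h
    exact hfi ⟨hf.aestronglyMeasurable,
      (hasFiniteIntegral_iff_ofReal hf0).2 (lt_top_iff_ne_top.2 h)⟩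
  rw [← ENNReal.tendsto_ofReal_nhds_top, ← htop]
  simp only [ofReal_integral_eq_lintegral_ofReal (integrable_min_const hf hf0 _) (hmin0 _)]
  refine lintegral_tendsto_of_tendsto_of_monotone (fun K ↦ by fun_prop)
    (ae_of_all _ fun ω i j hij ↦ by dsimp only; gcongr) (ae_of_all _ fun ω ↦ ?_)
  refine tendsto_const_nhds.congr' ?_
  filter_upwards [tendsto_natCast_atTop_atTop.eventually_ge_atTop (f ω)] with K hK
  rw [min_eq_left hK]

variable [IsProbabilityMeasure P]

theorem tendsto_sampleMean_atTop_ae (hX0 : 0 ≤ᵐ[P] X 0) (hint : ¬ Integrable (X 0) P)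
    (hindep : Pairwise (Function.onFun (· ⟂ᵢ[P] ·) X))
    (hident : ∀ i, IdentDistrib (X i) (X 0) P P) :
    ∀ᵐ ω ∂P, Tendsto (fun n ↦ sampleMean n (X · ω)) atTop atTop := by
  have htrunc : ∀ᵐ ω ∂P, ∀ K : ℕ,
      Tendsto (fun n ↦ sampleMean n fun i ↦ min (X i ω) K) atTop (𝓝 (∫ ω, min (X 0 ω) K ∂P)) := by
    refine ae_all_iff.2 fun K ↦ ?_
    have hmeas : Measurable fun x : ℝ ↦ min x K := by fun_prop
    exact tendsto_sampleMean_ae (X := fun i ω ↦ min (X i ω) K)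
      (integrable_min_const (hident 0).aemeasurable_fst hX0 K)
      (fun i j hij ↦ (hindep hij).comp hmeas hmeas) fun i ↦ (hident i).comp hmeas
  filter_upwards [htrunc] with ω hω
  refine tendsto_atTop.2 fun b ↦ ?_
  obtain ⟨K, hK⟩ := ((tendsto_integral_min_natCast_atTop (hident 0).aemeasurable_fst hX0
    hint).eventually_gt_atTop b).exists
  filter_upwards [(hω K).eventually_const_lt hK] with n hn
  exact hn.le.trans (sampleMean_mono n fun i ↦ min_le_left _ _)

theorem tendstoInDistribution_sqrt_mul_sampleMean_sub {Ω' : Type*} [MeasurableSpace Ω']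
    {P' : Measure Ω'} [IsProbabilityMeasure P'] {W : Ω' → ℝ}
    (hW : HasLaw W (gaussianReal 0 Var[X 0; P].toNNReal) P') (hX : MemLp (X 0) 2 P)
    (hindep : iIndepFun X P) (hident : ∀ i, IdentDistrib (X i) (X 0) P P) :
    TendstoInDistribution (fun (n : ℕ) ω ↦ √(n : ℝ) * (sampleMean n (X · ω) - P[X 0]))
      atTop W (fun _ ↦ P) P' := by
  convert tendstoInDistribution_inv_sqrt_mul_sum_sub hW hX hindep hident using 3 with n ω
  rcases eq_or_ne n 0 with rfl | hn
  · simp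
  have hsq : √(n : ℝ) ^ 2 = n := Real.sq_sqrt n.cast_nonneg
  have hsqrt : √(n : ℝ) ≠ 0 := Real.sqrt_ne_zero'.2 (by positivity)
  rw [sampleMean_eq_div]
  field_simp
  rw [hsq]

theorem tendstoInMeasure_sqrt_mul_sampleMean_sub_mul {B : ℕ → Ω → ℝ} (hX : MemLp (X 0) 2 P)
    (hindep : iIndepFun X P) (hident : ∀ i, IdentDistrib (X i) (X 0) P P)
    (hB : ∀ n, AEMeasurable (B n) P) (hB0 : ∀ᵐ ω ∂P, Tendsto (B · ω) atTop (𝓝 0)) :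
    TendstoInMeasure P
      (fun (n : ℕ) ω ↦ √(n : ℝ) * (sampleMean n (X · ω) - P[X 0]) * B n ω) atTop fun _ ↦ 0 :=
  tendstoInMeasure_mul_zero
    (tendstoInDistribution_sqrt_mul_sampleMean_sub HasLaw.id hX hindep hident) hB hB0

end IndependentIdenticallyDistributed

section PopulationKurtosis

variable {Ω : Type*} [MeasurableSpace Ω]

/-- The standardization of the random variable `X`: centred and divided by its standard deviation.
It is `0` when the variance of `X` is `0`. -/
noncomputable def standardized (X : Ω → ℝ) (P : Measure Ω) (ω : Ω) : ℝ :=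
  (X ω - P[X]) / √Var[X; P]

/-- The skewness of `X`, i.e. the third moment of its standardization. -/
noncomputable def skewness (X : Ω → ℝ) (P : Measure Ω) : ℝ := ∫ ω, standardized X P ω ^ 3 ∂P

/-- The kurtosis of `X`, i.e. the fourth moment of its standardization (`3` for a Gaussian
variable: this is not the excess kurtosis). -/
noncomputable def kurtosis (X : Ω → ℝ) (P : Measure Ω) : ℝ := ∫ ω, standardized X P ω ^ 4 ∂P

/-- The influence function of the kurtosis functional at the law of `X`, evaluated at `X`. With `Z`
the standardization, `γ` the skewness and `κ` the kurtosis of `X`, it is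
`(Z ^ 2 - κ) ^ 2 - κ * (κ - 1) - 4 * γ * Z`, the derivative of the kurtosis when the law of `X` is
perturbed by a point mass. -/
noncomputable def kurtosisInfluence (X : Ω → ℝ) (P : Measure Ω) (ω : Ω) : ℝ :=
  standardized X P ω ^ 4 - 2 * kurtosis X P * standardized X P ω ^ 2 + kurtosis X P
    - 4 * skewness X P * standardized X P ω

variable {P : Measure Ω} {X : Ω → ℝ}

theorem integral_standardized_pow (X : Ω → ℝ) (P : Measure Ω) (k : ℕ) :
    ∫ ω, standardized X P ω ^ k ∂P = centralMoment X k P / √Var[X; P] ^ k := by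
  simp only [standardized, div_pow, integral_div, centralMoment, Pi.pow_apply, Pi.sub_apply]

theorem kurtosis_eq_centralMoment_div (hX : AEMeasurable X P) :
    kurtosis X P = centralMoment X 4 P / centralMoment X 2 P ^ 2 := by
  rw [kurtosis, integral_standardized_pow, centralMoment_two_eq_variance hX,
    show √Var[X; P] ^ 4 = (√Var[X; P] ^ 2) ^ 2 by ring, Real.sq_sqrt (variance_nonneg X P)]

theorem integral_standardized [IsProbabilityMeasure P] (X : Ω → ℝ) :
    ∫ ω, standardized X P ω ∂P = 0 := by
  simpa [centralMoment_one] using integral_standardized_pow X P 1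

theorem integral_standardized_sq (hX : AEMeasurable X P) (hvar : Var[X; P] ≠ 0) :
    ∫ ω, standardized X P ω ^ 2 ∂P = 1 := by
  rw [integral_standardized_pow, centralMoment_two_eq_variance hX,
    Real.sq_sqrt (variance_nonneg X P), div_self hvar]

theorem integrable_pow_iff_memLp [IsFiniteMeasure P] (hX : AEStronglyMeasurable X P) (k : ℕ) :
    Integrable (fun ω ↦ X ω ^ k) P ↔ MemLp X k P := by
  rcases eq_or_ne k 0 with rfl | hk
  · simpa using hX
  rw [← integrable_norm_iff (by fun_prop), ← integrable_norm_rpow_iff hX (by exact_mod_cast hk)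
    (ENNReal.natCast_ne_top k)]
  simp

theorem integrable_pow_of_memLp [IsFiniteMeasure P] {k j : ℕ} (hX : MemLp X k P) (hj : j ≤ k) :
    Integrable (fun ω ↦ X ω ^ j) P :=
  (integrable_pow_iff_memLp hX.aestronglyMeasurable j).2 (hX.mono_exponent (by exact_mod_cast hj))

theorem memLp_standardized [IsFiniteMeasure P] {p : ℝ≥0∞} (hX : MemLp X p P) :
    MemLp (standardized X P) p P := by
  unfold standardized
  simp only [div_eq_mul_inv]
  exact (hX.sub (memLp_const P[X])).mul_const (√Var[X; P])⁻¹

theorem centralMoment_eq_sum [IsFiniteMeasure P] {k : ℕ} (hX : MemLp X k P) :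
    centralMoment X k P = ∑ j ∈ Finset.range (k + 1),
      (∫ ω, X ω ^ j ∂P) * (-P[X]) ^ (k - j) * k.choose j := by
  simp only [centralMoment, Pi.pow_apply, Pi.sub_apply, sub_eq_add_neg (X _), add_pow]
  rw [integral_finsetSum _ fun j hj ↦ ((integrable_pow_of_memLp hX
    (Nat.lt_succ_iff.1 (Finset.mem_range.1 hj))).mul_const _).mul_const _]
  simp only [integral_mul_const]

end PopulationKurtosis

section Consistency

variable {Ω : Type*} [MeasurableSpace Ω] {P : Measure Ω} [IsProbabilityMeasure P]
  {y : ℕ → Ω → ℝ}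

theorem tendsto_sampleMean_pow_ae {k : ℕ} (hy : MemLp (y 0) k P)
    (hindep : Pairwise (Function.onFun (· ⟂ᵢ[P] ·) y))
    (hident : ∀ i, IdentDistrib (y i) (y 0) P P) :
    ∀ᵐ ω ∂P, ∀ j ≤ k,
      Tendsto (fun n ↦ sampleMean n fun i ↦ y i ω ^ j) atTop (𝓝 (∫ ω, y 0 ω ^ j ∂P)) := by
  refine ae_all_iff.2 fun j ↦ eventually_imp_distrib_left.2 fun hj ↦ ?_
  have hmeas : Measurable fun x : ℝ ↦ x ^ j := by fun_prop
  exact tendsto_sampleMean_ae (X := fun i ω ↦ y i ω ^ j) (integrable_pow_of_memLp hy hj)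
    (fun a b hab ↦ (hindep hab).comp hmeas hmeas) fun i ↦ (hident i).comp hmeas

theorem tendsto_centralSampleMoment_ae {k : ℕ} (hk : k ≠ 0) (hy : MemLp (y 0) k P)
    (hindep : Pairwise (Function.onFun (· ⟂ᵢ[P] ·) y))
    (hident : ∀ i, IdentDistrib (y i) (y 0) P P) :
    ∀ᵐ ω ∂P, Tendsto (fun n ↦ centralSampleMoment k n (y · ω)) atTop
      (𝓝 (centralMoment (y 0) k P)) := by
  filter_upwards [tendsto_sampleMean_pow_ae hy hindep hident] with ω hω
  have hmean : Tendsto (fun n ↦ sampleMean n (y · ω)) atTop (𝓝 P[y 0]) := by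
    simpa using hω 1 (Nat.one_le_iff_ne_zero.2 hk)
  simp only [centralSampleMoment_eq_sum, centralMoment_eq_sum hy]
  exact tendsto_finsetSum _ fun j hj ↦ ((hω j (Nat.lt_succ_iff.1 (Finset.mem_range.1 hj))).mul
    (hmean.neg.pow _)).mul_const _

theorem tendsto_centralSampleMoment_atTop_ae {k : ℕ} (hk : Even k) (hint : Integrable (y 0) P)
    (hy : ¬ MemLp (y 0) k P) (hindep : Pairwise (Function.onFun (· ⟂ᵢ[P] ·) y))
    (hident : ∀ i, IdentDistrib (y i) (y 0) P P) :
    ∀ᵐ ω ∂P, Tendsto (fun n ↦ centralSampleMoment k n (y · ω)) atTop atTop := by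
  have hmeas : Measurable fun x : ℝ ↦ x ^ k := by fun_prop
  have hpow := tendsto_sampleMean_atTop_ae (X := fun i ω ↦ y i ω ^ k)
    (ae_of_all _ fun ω ↦ hk.pow_nonneg _)
    (mt (integrable_pow_iff_memLp hint.aestronglyMeasurable k).1 hy)
    (fun a b hab ↦ (hindep hab).comp hmeas hmeas) fun i ↦ (hident i).comp hmeas
  filter_upwards [tendsto_sampleMean_ae hint hindep hident, hpow] with ω hmean hω
  refine tendsto_atTop_mono (fun n ↦ sampleMean_pow_div_sub_le_centralSampleMoment hk n _) ?_
  simp only [sub_eq_add_neg]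
  exact (hω.atTop_div_const (by positivity)).atTop_add (hmean.pow k).neg

theorem tendsto_centralSampleMoment_two_ae (hy : MemLp (y 0) 2 P)
    (hindep : Pairwise (Function.onFun (· ⟂ᵢ[P] ·) y))
    (hident : ∀ i, IdentDistrib (y i) (y 0) P P) :
    ∀ᵐ ω ∂P, Tendsto (fun n ↦ centralSampleMoment 2 n (y · ω)) atTop (𝓝 Var[y 0; P]) := by
  rw [← centralMoment_two_eq_variance hy.aemeasurable]
  exact tendsto_centralSampleMoment_ae two_ne_zero hy hindep hident

theorem tendsto_sampleKurtosis_ae (hy : MemLp (y 0) 4 P) (hvar : Var[y 0; P] ≠ 0)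
    (hindep : Pairwise (Function.onFun (· ⟂ᵢ[P] ·) y))
    (hident : ∀ i, IdentDistrib (y i) (y 0) P P) :
    ∀ᵐ ω ∂P, Tendsto (fun n ↦ sampleKurtosis n (y · ω)) atTop (𝓝 (kurtosis (y 0) P)) := by
  have hy2 : MemLp (y 0) 2 P := hy.mono_exponent (by norm_num)
  rw [kurtosis_eq_centralMoment_div hy.aemeasurable, centralMoment_two_eq_variance hy.aemeasurable]
  filter_upwards [tendsto_centralSampleMoment_ae four_ne_zero hy hindep hident,
    tendsto_centralSampleMoment_two_ae hy2 hindep hident] with ω h4 h2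
  exact h4.div (h2.pow 2) (pow_ne_zero 2 hvar)

theorem tendsto_sampleKurtosis_atTop_ae (hy2 : MemLp (y 0) 2 P) (hy4 : ¬ MemLp (y 0) 4 P)
    (hvar : Var[y 0; P] ≠ 0) (hindep : Pairwise (Function.onFun (· ⟂ᵢ[P] ·) y))
    (hident : ∀ i, IdentDistrib (y i) (y 0) P P) :
    ∀ᵐ ω ∂P, Tendsto (fun n ↦ sampleKurtosis n (y · ω)) atTop atTop := by
  filter_upwards [tendsto_centralSampleMoment_atTop_ae (k := 4) (by decide)
      (hy2.integrable one_le_two) hy4 hindep hident,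
    tendsto_centralSampleMoment_two_ae hy2 hindep hident] with ω h4 h2
  simp only [sampleKurtosis, div_eq_mul_inv]
  exact h4.atTop_mul_pos (inv_pos.2 (by positivity)) ((h2.pow 2).inv₀ (pow_ne_zero 2 hvar))

theorem tendsto_sqrt_mul_sampleKurtosis_sub_atTop_ae {c : ℝ} (hy : MemLp (y 0) 2 P)
    (hvar : Var[y 0; P] ≠ 0) (hc : MemLp (y 0) 4 P → c < kurtosis (y 0) P)
    (hindep : Pairwise (Function.onFun (· ⟂ᵢ[P] ·) y))
    (hident : ∀ i, IdentDistrib (y i) (y 0) P P) :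
    ∀ᵐ ω ∂P, Tendsto (fun n : ℕ ↦ √(n : ℝ) * (sampleKurtosis n (y · ω) - c)) atTop atTop := by
  have hsqrt : Tendsto (fun n : ℕ ↦ √(n : ℝ)) atTop atTop :=
    Real.tendsto_sqrt_atTop.comp tendsto_natCast_atTop_atTop
  by_cases hy4 : MemLp (y 0) 4 P
  · filter_upwards [tendsto_sampleKurtosis_ae hy4 hvar hindep hident] with ω hω
    exact hsqrt.atTop_mul_pos (sub_pos.2 (hc hy4)) (hω.sub_const c)
  · filter_upwards [tendsto_sampleKurtosis_atTop_ae hy hy4 hvar hindep hident] with ω hω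
    exact hsqrt.atTop_mul_atTop₀ (tendsto_atTop_add_const_right _ (-c) hω)

end Consistency

section CentralLimit

variable {Ω : Type*} [MeasurableSpace Ω] {P : Measure Ω}

theorem centralSampleMoment_four_sub_mul_sq {n : ℕ} (hn : n ≠ 0) (κ γ : ℝ) (y : ℕ → ℝ) :
    centralSampleMoment 4 n y - κ * centralSampleMoment 2 n y ^ 2 =
      sampleMean n (fun i ↦ y i ^ 4 - 2 * κ * y i ^ 2 + κ - 4 * γ * y i)
      + -κ * (sampleMean n (fun i ↦ y i ^ 2) - 1) ^ 2
      + sampleMean n y * (-4 * (sampleMean n (fun i ↦ y i ^ 3) - γ)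
        + (6 + 2 * κ) * sampleMean n y * sampleMean n (fun i ↦ y i ^ 2)
        - (3 + κ) * sampleMean n y ^ 3) := by
  rw [centralSampleMoment_two, centralSampleMoment_four, sampleMean_sub, sampleMean_add,
    sampleMean_sub, sampleMean_const hn, sampleMean_const_mul, sampleMean_const_mul]
  ring

theorem memLp_two_pow_of_memLp [IsFiniteMeasure P] {X : Ω → ℝ} {j k : ℕ} (hX : MemLp X k P)
    (hj : j * 2 ≤ k) : MemLp (fun ω ↦ X ω ^ j) 2 P := by
  have hXm := hX.aestronglyMeasurable
  rw [memLp_two_iff_integrable_sq (by fun_prop)]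
  simpa only [← pow_mul] using integrable_pow_of_memLp hX hj

theorem memLp_two_kurtosisInfluence [IsFiniteMeasure P] {X : Ω → ℝ} (hX : MemLp X 8 P) :
    MemLp (kurtosisInfluence X P) 2 P := by
  have hpow {j : ℕ} (hj : j * 2 ≤ 8) : MemLp (fun ω ↦ standardized X P ω ^ j) 2 P :=
    memLp_two_pow_of_memLp (memLp_standardized hX) hj
  have h1 : MemLp (standardized X P) 2 P := by simpa using hpow (j := 1) (by norm_num)
  exact (((hpow (j := 4) le_rfl).sub ((hpow (j := 2) (by norm_num)).const_mul _)).add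
    (memLp_const _)).sub (h1.const_mul _)

theorem standardized_eq_self {X : Ω → ℝ} (hmean : P[X] = 0) (hvar : Var[X; P] = 1) :
    standardized X P = X := by
  funext ω
  simp [standardized, hmean, hvar]

variable [IsProbabilityMeasure P]

theorem integral_kurtosisInfluence {X : Ω → ℝ} (hX : MemLp X 4 P) (hvar : Var[X; P] ≠ 0) :
    ∫ ω, kurtosisInfluence X P ω ∂P = 0 := by
  have hpow {j : ℕ} (hj : j ≤ 4) : Integrable (fun ω ↦ standardized X P ω ^ j) P :=
    integrable_pow_of_memLp (memLp_standardized hX) hj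
  have h1 : Integrable (standardized X P) P := by simpa using hpow (j := 1) (by norm_num)
  have h2 := (hpow (j := 2) (by norm_num)).const_mul (2 * kurtosis X P)
  have h4 := hpow le_rfl
  have h42 : Integrable
      (fun ω ↦ standardized X P ω ^ 4 - 2 * kurtosis X P * standardized X P ω ^ 2) P := h4.sub h2
  simp only [kurtosisInfluence]
  rw [integral_sub (h42.fun_add (integrable_const _)) (h1.const_mul _),
    integral_add h42 (integrable_const _), integral_sub h4 h2, integral_const_mul,
    integral_const_mul, integral_standardized, integral_standardized_sq hX.aemeasurable hvar,
    ← kurtosis, integral_const, probReal_univ]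
  simp only [smul_eq_mul]
  ring

theorem variance_standardized {X : Ω → ℝ} (hX : AEMeasurable X P) (hvar : Var[X; P] ≠ 0) :
    Var[standardized X P; P] = 1 := by
  have hmeas : AEMeasurable (standardized X P) P := (hX.sub_const _).div_const _
  rw [variance_of_integral_eq_zero hmeas (integral_standardized X),
    integral_standardized_sq hX hvar]

variable {y : ℕ → Ω → ℝ}

theorem tendstoInMeasure_sqrt_mul_sampleMean_sub_sq (hy : MemLp (y 0) 2 P)
    (hindep : iIndepFun y P) (hident : ∀ i, IdentDistrib (y i) (y 0) P P) (c : ℝ) :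
    TendstoInMeasure P
      (fun (n : ℕ) ω ↦ √(n : ℝ) * (c * (sampleMean n (y · ω) - P[y 0]) ^ 2)) atTop fun _ ↦ 0 := by
  have hym (i : ℕ) : AEMeasurable (y i) P := (hident i).aemeasurable_fst
  have hlim : ∀ᵐ ω ∂P,
      Tendsto (fun n ↦ c * (sampleMean n (y · ω) - P[y 0])) atTop (𝓝 0) := by
    filter_upwards [tendsto_sampleMean_ae (hy.integrable one_le_two)
      (fun i j hij ↦ hindep.indepFun hij) hident] with ω hω
    simpa using (hω.sub_const P[y 0]).const_mul c
  refine (tendstoInMeasure_sqrt_mul_sampleMean_sub_mul hy hindep hident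
    (fun n ↦ by simp only [sampleMean]; fun_prop) hlim).congr_left fun n ↦ ae_of_all _ fun ω ↦ ?_
  ring

theorem tendstoInMeasure_sqrt_mul_sampleMean_mul_cubic (hy : MemLp (y 0) 3 P)
    (hmean : P[y 0] = 0) (hindep : iIndepFun y P)
    (hident : ∀ i, IdentDistrib (y i) (y 0) P P) (a b : ℝ) :
    TendstoInMeasure P (fun (n : ℕ) ω ↦ √(n : ℝ) * (sampleMean n (y · ω) *
      (-4 * (sampleMean n (fun i ↦ y i ω ^ 3) - ∫ ω, y 0 ω ^ 3 ∂P)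
        + a * sampleMean n (y · ω) * sampleMean n (fun i ↦ y i ω ^ 2)
        - b * sampleMean n (y · ω) ^ 3))) atTop fun _ ↦ 0 := by
  have hym (i : ℕ) : AEMeasurable (y i) P := (hident i).aemeasurable_fst
  have hlim : ∀ᵐ ω ∂P, Tendsto (fun n ↦
      -4 * (sampleMean n (fun i ↦ y i ω ^ 3) - ∫ ω, y 0 ω ^ 3 ∂P)
        + a * sampleMean n (y · ω) * sampleMean n (fun i ↦ y i ω ^ 2)
        - b * sampleMean n (y · ω) ^ 3) atTop (𝓝 0) := by
    filter_upwards [tendsto_sampleMean_pow_ae (k := 3) (by exact_mod_cast hy)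
      (fun i j hij ↦ hindep.indepFun hij) hident] with ω hω
    have hω1 : Tendsto (fun n ↦ sampleMean n (y · ω)) atTop (𝓝 0) := by
      simpa [hmean] using hω 1 (by norm_num)
    have hω3 := ((hω 3 le_rfl).sub_const (∫ ω, y 0 ω ^ 3 ∂P)).const_mul (-4)
    simpa using (hω3.add ((hω1.const_mul a).mul (hω 2 (by norm_num)))).sub
      ((hω1.pow 3).const_mul b)
  simpa only [hmean, sub_zero, mul_assoc] using tendstoInMeasure_sqrt_mul_sampleMean_sub_mul
    (hy.mono_exponent (by norm_num)) hindep hident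
    (fun n ↦ by simp only [sampleMean]; fun_prop) hlim

variable {Ω' : Type*} [MeasurableSpace Ω'] {P' : Measure Ω'}
  [IsProbabilityMeasure P'] {W : Ω' → ℝ}

theorem tendstoInDistribution_sqrt_mul_sampleMean_kurtosisInfluence (hy : MemLp (y 0) 8 P)
    (hstd : standardized (y 0) P = y 0) (hvar : Var[y 0; P] ≠ 0)
    (hW : HasLaw W (gaussianReal 0 Var[kurtosisInfluence (y 0) P; P].toNNReal) P')
    (hindep : iIndepFun y P) (hident : ∀ i, IdentDistrib (y i) (y 0) P P) :
    TendstoInDistribution (fun (n : ℕ) ω ↦ √(n : ℝ) * sampleMean n fun i ↦ y i ω ^ 4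
      - 2 * kurtosis (y 0) P * y i ω ^ 2 + kurtosis (y 0) P - 4 * skewness (y 0) P * y i ω)
      atTop W (fun _ ↦ P) P' := by
  have hzero := integral_kurtosisInfluence (hy.mono_exponent (by norm_num)) hvar
  have hmem := memLp_two_kurtosisInfluence hy
  unfold kurtosisInfluence at hzero hmem hW
  rw [hstd] at hzero hmem hW
  generalize kurtosis (y 0) P = κ at *
  generalize skewness (y 0) P = γ at *
  have hu : Measurable fun x : ℝ ↦ x ^ 4 - 2 * κ * x ^ 2 + κ - 4 * γ * x := by fun_prop
  have h := tendstoInDistribution_sqrt_mul_sampleMean_sub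
    (X := fun i ω ↦ y i ω ^ 4 - 2 * κ * y i ω ^ 2 + κ - 4 * γ * y i ω) hW hmem
    (hindep.comp _ fun _ ↦ hu) fun i ↦ (hident i).comp hu
  simpa only [hzero, sub_zero] using h

theorem tendstoInDistribution_sqrt_mul_centralSampleMoment_four_sub (hy : MemLp (y 0) 8 P)
    (hmean : P[y 0] = 0) (hvar : Var[y 0; P] = 1)
    (hW : HasLaw W (gaussianReal 0 Var[kurtosisInfluence (y 0) P; P].toNNReal) P')
    (hindep : iIndepFun y P) (hident : ∀ i, IdentDistrib (y i) (y 0) P P) :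
    TendstoInDistribution (fun (n : ℕ) ω ↦ √(n : ℝ) * (centralSampleMoment 4 n (y · ω)
      - kurtosis (y 0) P * centralSampleMoment 2 n (y · ω) ^ 2)) atTop W (fun _ ↦ P) P' := by
  have hym (i : ℕ) : AEMeasurable (y i) P := (hident i).aemeasurable_fst
  have hstd := standardized_eq_self hmean hvar
  have hsq : ∫ ω, y 0 ω ^ 2 ∂P = 1 := by rw [← variance_of_integral_eq_zero (hym 0) hmean, hvar]
  have hskew : skewness (y 0) P = ∫ ω, y 0 ω ^ 3 ∂P := by rw [skewness, hstd]
  have hquad := tendstoInMeasure_sqrt_mul_sampleMean_sub_sq (y := fun i ω ↦ y i ω ^ 2)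
    (memLp_two_pow_of_memLp (k := 8) (by exact_mod_cast hy) (by norm_num))
    (hindep.comp (fun _ x ↦ x ^ 2) fun _ ↦ by fun_prop)
    (fun i ↦ (hident i).comp (u := fun x ↦ x ^ 2) (by fun_prop)) (-kurtosis (y 0) P)
  have hcubic := tendstoInMeasure_sqrt_mul_sampleMean_mul_cubic (hy.mono_exponent (by norm_num))
    hmean hindep hident (6 + 2 * kurtosis (y 0) P) (3 + kurtosis (y 0) P)
  have hsum := ((tendstoInDistribution_sqrt_mul_sampleMean_kurtosisInfluence hy hstd
    (by simp [hvar]) hW hindep hident).add_of_tendstoInMeasure_const hquad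
      fun n ↦ by simp only [sampleMean]; fun_prop).add_of_tendstoInMeasure_const hcubic
      fun n ↦ by simp only [sampleMean]; fun_prop
  simp only [add_zero] at hsum
  refine hsum.congr (fun n ↦ ae_of_all _ fun ω ↦ ?_) .rfl
  simp only [Pi.add_apply]
  rcases eq_or_ne n 0 with rfl | hn
  · simp
  rw [centralSampleMoment_four_sub_mul_sq hn _ (skewness (y 0) P), hskew, hsq]
  ring

theorem tendstoInDistribution_sqrt_mul_sampleKurtosis_sub_of_standardized (hy : MemLp (y 0) 8 P)
    (hmean : P[y 0] = 0) (hvar : Var[y 0; P] = 1)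
    (hW : HasLaw W (gaussianReal 0 Var[kurtosisInfluence (y 0) P; P].toNNReal) P')
    (hindep : iIndepFun y P) (hident : ∀ i, IdentDistrib (y i) (y 0) P P) :
    TendstoInDistribution
      (fun (n : ℕ) ω ↦ √(n : ℝ) * (sampleKurtosis n (y · ω) - kurtosis (y 0) P))
      atTop W (fun _ ↦ P) P' := by
  have hym (i : ℕ) : AEMeasurable (y i) P := (hident i).aemeasurable_fst
  have hc2 : ∀ᵐ ω ∂P, Tendsto (fun n ↦ centralSampleMoment 2 n (y · ω)) atTop (𝓝 1) :=
    hvar ▸ tendsto_centralSampleMoment_two_ae (hy.mono_exponent (by norm_num))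
      (fun i j hij ↦ hindep.indepFun hij) hident
  have hquot := tendstoInDistribution_div_const
    (tendstoInDistribution_sqrt_mul_centralSampleMoment_four_sub hy hmean hvar hW hindep hident)
    (D := fun n ω ↦ centralSampleMoment 2 n (y · ω) ^ 2)
    (fun n ↦ by simp only [centralSampleMoment, sampleMean]; fun_prop)
    (hc2.mono fun ω hω ↦ hω.pow 2) (by norm_num)
  simp only [one_pow, div_one] at hquot
  refine tendstoInDistribution_of_ae_eventuallyEq hquot
    (fun n ↦ by simp only [sampleKurtosis, centralSampleMoment, sampleMean]; fun_prop) ?_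
  filter_upwards [hc2] with ω hω
  filter_upwards [hω.eventually_ne one_ne_zero] with n hn
  rw [sampleKurtosis]
  field_simp

theorem tendstoInDistribution_sqrt_mul_sampleKurtosis_sub (hy : MemLp (y 0) 8 P)
    (hvar : Var[y 0; P] ≠ 0)
    (hW : HasLaw W (gaussianReal 0 Var[kurtosisInfluence (y 0) P; P].toNNReal) P')
    (hindep : iIndepFun y P) (hident : ∀ i, IdentDistrib (y i) (y 0) P P) :
    TendstoInDistribution
      (fun (n : ℕ) ω ↦ √(n : ℝ) * (sampleKurtosis n (y · ω) - kurtosis (y 0) P))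
      atTop W (fun _ ↦ P) P' := by
  have hym : AEMeasurable (y 0) P := hy.aemeasurable
  have hsd : √Var[y 0; P] ≠ 0 := (Real.sqrt_ne_zero (variance_nonneg _ _)).2 hvar
  have hmeas : Measurable fun x : ℝ ↦ (x - P[y 0]) / √Var[y 0; P] := by fun_prop
  have hmean1 := integral_standardized (P := P) (y 0)
  have hvar1 := variance_standardized hym hvar
  have hstd : standardized (standardized (y 0) P) P = standardized (y 0) P :=
    standardized_eq_self hmean1 hvar1
  have hkurt : kurtosis (standardized (y 0) P) P = kurtosis (y 0) P := by
    simp only [kurtosis, hstd]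
  have hinfl : kurtosisInfluence (standardized (y 0) P) P = kurtosisInfluence (y 0) P := by
    funext ω
    simp only [kurtosisInfluence, hkurt, skewness, hstd]
  have hz0 : (fun ω ↦ (y 0 ω - P[y 0]) / √Var[y 0; P]) = standardized (y 0) P := rfl
  have h := tendstoInDistribution_sqrt_mul_sampleKurtosis_sub_of_standardized (P := P) (W := W)
    (P' := P') (y := fun i ω ↦ (y i ω - P[y 0]) / √Var[y 0; P])
  simp only [hz0, hkurt, hinfl, sampleKurtosis_sub_div _ _ hsd] at h
  exact h (memLp_standardized hy) hmean1 hvar1 hW (hindep.comp _ fun _ ↦ hmeas)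
    fun i ↦ (hident i).comp hmeas

end CentralLimit

section GaussianHermite

open Polynomial

theorem integrable_eval_gaussianReal (p : ℝ[X]) (μ : ℝ) (v : ℝ≥0) :
    Integrable (fun x ↦ p.eval x) (gaussianReal μ v) := by
  simp only [eval_eq_sum_range]
  exact integrable_finsetSum _ fun k _ ↦ (integrable_pow_of_memLp
    (memLp_id_gaussianReal' k (ENNReal.natCast_ne_top k)) le_rfl).const_mul _

theorem hasDerivAt_gaussianPDFReal (v : ℝ≥0) (x : ℝ) :
    HasDerivAt (gaussianPDFReal 0 v) (gaussianPDFReal 0 v x * (-(x / v))) x := by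
  have hexp : HasDerivAt (fun x : ℝ ↦ -(x - 0) ^ 2 / (2 * v)) (-(x / v)) x := by
    refine (((((hasDerivAt_id x).sub_const 0).pow 2).neg).div_const (2 * (v : ℝ))).congr_deriv ?_
    rcases eq_or_ne (v : ℝ) 0 with hv | hv
    · simp [hv]
    · simp only [id_eq, sub_zero, Nat.cast_ofNat, Nat.add_one_sub_one, pow_one, mul_one]
      field_simp
  refine (hexp.exp.const_mul _).congr_deriv ?_
  rw [gaussianPDFReal]
  ring

theorem integral_mul_eval_gaussianReal (p : ℝ[X]) (v : ℝ≥0) :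
    ∫ x, x * p.eval x ∂gaussianReal 0 v = v * ∫ x, p.derivative.eval x ∂gaussianReal 0 v := by
  rcases eq_or_ne v 0 with rfl | hv
  · simp
  have hint (q : ℝ[X]) : Integrable (fun x ↦ gaussianPDFReal 0 v x * q.eval x) := by
    have h := integrable_eval_gaussianReal q 0 v
    rw [gaussianReal_of_var_ne_zero 0 hv, integrable_withDensity_iff_integrable_smul'
      (measurable_gaussianPDF 0 v) (ae_of_all _ fun _ ↦ gaussianPDF_lt_top)] at h
    simpa [toReal_gaussianPDF] using h
  have hderiv (x : ℝ) : HasDerivAt (fun x ↦ gaussianPDFReal 0 v x * p.eval x)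
      (gaussianPDFReal 0 v x * p.derivative.eval x
        - (v : ℝ)⁻¹ * (gaussianPDFReal 0 v x * (X * p).eval x)) x := by
    refine ((hasDerivAt_gaussianPDFReal v x).mul (p.hasDerivAt x)).congr_deriv ?_
    simp only [eval_mul, eval_X]
    ring
  have hzero := integral_eq_zero_of_hasDerivAt_of_integrable hderiv
    ((hint _).sub ((hint _).const_mul _)) (hint p)
  rw [integral_sub (hint _) ((hint _).const_mul _), integral_const_mul, sub_eq_zero,
    eq_inv_mul_iff_mul_eq₀ (by exact_mod_cast hv)] at hzero
  simpa only [integral_gaussianReal_eq_integral_smul hv, smul_eq_mul, eval_mul, eval_X]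
    using hzero.symm

theorem integral_pow_add_two_gaussianReal (v : ℝ≥0) (k : ℕ) :
    ∫ x, x ^ (k + 2) ∂gaussianReal 0 v = (k + 1) * v * ∫ x, x ^ k ∂gaussianReal 0 v := by
  have h := integral_mul_eval_gaussianReal (X ^ (k + 1)) v
  simp only [eval_pow, eval_X, ← pow_succ', derivative_X_pow_succ, eval_mul, eval_C,
    integral_const_mul] at h
  rw [h]
  ring

theorem integral_hermite_mul_gaussianReal (n : ℕ) (p : ℝ[X]) :
    ∫ x, aeval x (hermite n) * p.eval x ∂gaussianReal 0 1 =
      ∫ x, (derivative^[n] p).eval x ∂gaussianReal 0 1 := by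
  induction n generalizing p with
  | zero => simp
  | succ n ih =>
    set H : ℝ[X] := (hermite n).map (algebraMap ℤ ℝ) with hH
    have hint (q : ℝ[X]) := integrable_eval_gaussianReal q 0 1
    have hstein := integral_mul_eval_gaussianReal (H * p) 1
    calc ∫ x, aeval x (hermite (n + 1)) * p.eval x ∂gaussianReal 0 1
      _ = ∫ x, ((X * (H * p)).eval x - (derivative H * p).eval x) ∂gaussianReal 0 1 := by
        simp [hermite_succ, hH, aeval_def, eval_map, sub_mul, mul_assoc, derivative_map]
      _ = ∫ x, (H * derivative p).eval x ∂gaussianReal 0 1 := by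
        rw [integral_sub (hint _) (hint _), sub_eq_iff_eq_add, ← integral_add (hint _) (hint _)]
        simpa only [derivative_mul, eval_add, eval_mul, eval_X, NNReal.coe_one, one_mul,
          add_comm] using hstein
      _ = ∫ x, (derivative^[n + 1] p).eval x ∂gaussianReal 0 1 := by
        rw [Function.iterate_succ_apply, ← ih]
        simp [hH, aeval_def, eval_map]

theorem integral_hermite_gaussianReal {n : ℕ} (hn : n ≠ 0) :
    ∫ x, (aeval x (hermite n) : ℝ) ∂gaussianReal 0 1 = 0 := by
  simpa [iterate_derivative_one (Nat.pos_of_ne_zero hn)] using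
    integral_hermite_mul_gaussianReal n 1

theorem variance_hermite_gaussianReal {n : ℕ} (hn : n ≠ 0) :
    Var[fun x ↦ (aeval x (hermite n) : ℝ); gaussianReal 0 1] = n.factorial := by
  set H : ℝ[X] := (hermite n).map (algebraMap ℤ ℝ) with hH
  have hderiv : derivative^[n] H = C (n.factorial : ℝ) := by
    have hdeg : (derivative^[n] H).natDegree ≤ 0 := by
      refine (natDegree_iterate_derivative H n).trans (Nat.sub_eq_zero_of_le ?_).le
      exact natDegree_map_le.trans natDegree_hermite.le
    rw [eq_C_of_natDegree_le_zero hdeg, coeff_iterate_derivative]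
    simp [hH, Nat.descFactorial_self]
  rw [variance_of_integral_eq_zero (by fun_prop) (integral_hermite_gaussianReal hn)]
  have h := integral_hermite_mul_gaussianReal n H
  rw [hderiv] at h
  simpa [hH, eval_map, aeval_def, sq] using h

end GaussianHermite

section GaussianKurtosis

variable {Ω : Type*} [MeasurableSpace Ω] {P : Measure Ω} {X : Ω → ℝ}
  {μ : ℝ} {v : ℝ≥0}

theorem hasLaw_standardized_of_gaussianReal (hX : HasLaw X (gaussianReal μ v) P) (hv : v ≠ 0) :
    HasLaw (standardized X P) (gaussianReal 0 1) P := by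
  have hmean : P[X] = μ := by rw [hX.integral_eq, integral_id_gaussianReal]
  have hvar : Var[X; P] = v := by rw [hX.variance_eq, variance_id_gaussianReal]
  have hunit : v / .mk (√Var[X; P] ^ 2) (sq_nonneg _) = 1 := by
    rw [div_eq_one_iff_eq (by simp [hvar, hv])]
    exact NNReal.coe_injective (by simp [hvar])
  have h := gaussianReal_div_const (gaussianReal_sub_const hX P[X]) √Var[X; P]
  rwa [hunit, sub_eq_zero.2 hmean.symm, zero_div] at h

theorem integral_standardized_pow_of_gaussianReal (hX : HasLaw X (gaussianReal μ v) P)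
    (hv : v ≠ 0) (k : ℕ) : ∫ ω, standardized X P ω ^ k ∂P = ∫ x, x ^ k ∂gaussianReal 0 1 :=
  (hasLaw_standardized_of_gaussianReal hX hv).integral_comp (f := fun x ↦ x ^ k) (by fun_prop)

theorem skewness_of_gaussianReal (hX : HasLaw X (gaussianReal μ v) P) (hv : v ≠ 0) :
    skewness X P = 0 := by
  rw [skewness, integral_standardized_pow_of_gaussianReal hX hv,
    integral_pow_add_two_gaussianReal 1 1]
  simp

theorem kurtosis_of_gaussianReal (hX : HasLaw X (gaussianReal μ v) P) (hv : v ≠ 0) :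
    kurtosis X P = 3 := by
  rw [kurtosis, integral_standardized_pow_of_gaussianReal hX hv,
    integral_pow_add_two_gaussianReal 1 2, integral_pow_add_two_gaussianReal 1 0]
  norm_num

open Polynomial in
theorem kurtosisInfluence_of_gaussianReal (hX : HasLaw X (gaussianReal μ v) P) (hv : v ≠ 0) :
    kurtosisInfluence X P = fun ω ↦ aeval (standardized X P ω) (hermite 4) := by
  funext ω
  rw [kurtosisInfluence, skewness_of_gaussianReal hX hv, kurtosis_of_gaussianReal hX hv]
  simp only [hermite_succ, hermite_zero, map_one, mul_one, one_mul, mul_zero, zero_mul, sub_zero,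
    derivative_one, derivative_X, derivative_sub, derivative_mul, aeval_sub, map_mul, aeval_X,
    map_add]
  ring

theorem variance_kurtosisInfluence_of_gaussianReal (hX : HasLaw X (gaussianReal μ v) P)
    (hv : v ≠ 0) : Var[kurtosisInfluence X P; P] = 24 := by
  have hZ := hasLaw_standardized_of_gaussianReal hX hv
  have hmap := variance_map (μ := P) (Y := standardized X P)
    (X := fun x ↦ Polynomial.aeval x (Polynomial.hermite 4)) (by fun_prop) hZ.aemeasurable
  rw [hZ.map_eq, variance_hermite_gaussianReal four_ne_zero] at hmap
  rw [kurtosisInfluence_of_gaussianReal hX hv]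
  exact hmap.symm.trans (by norm_num [Nat.factorial])

end GaussianKurtosis

section StudentKernel

variable {c r : ℝ} {k : ℕ}

theorem continuous_one_add_sq_div_rpow (hc : 0 < c) (r : ℝ) :
    Continuous fun x : ℝ ↦ (1 + x ^ 2 / c) ^ r :=
  (by fun_prop : Continuous fun x : ℝ ↦ 1 + x ^ 2 / c).rpow_const fun x ↦ .inl (by positivity)

theorem abs_pow_mul_one_add_sq_div_rpow_le (hc : 0 < c) (r : ℝ) (k : ℕ) (x : ℝ) :
    |x ^ k * (1 + x ^ 2 / c) ^ r| ≤ c ^ (k / 2 : ℝ) * (1 + x ^ 2 / c) ^ (k / 2 + r : ℝ) := by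
  have hp : 0 < 1 + x ^ 2 / c := by positivity
  have hx : |x ^ k| = (x ^ 2) ^ (k / 2 : ℝ) := by
    rw [abs_pow, ← sq_abs x, ← Real.rpow_two, ← Real.rpow_mul (abs_nonneg x),
      mul_div_cancel₀ _ two_ne_zero, Real.rpow_natCast]
  have hle : x ^ 2 ≤ c * (1 + x ^ 2 / c) := by
    rw [mul_add, mul_one, mul_div_cancel₀ _ hc.ne']
    linarith
  calc |x ^ k * (1 + x ^ 2 / c) ^ r| = (x ^ 2) ^ (k / 2 : ℝ) * (1 + x ^ 2 / c) ^ r := by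
        rw [abs_mul, hx, abs_of_nonneg (by positivity)]
    _ ≤ (c * (1 + x ^ 2 / c)) ^ (k / 2 : ℝ) * (1 + x ^ 2 / c) ^ r := by gcongr
    _ = c ^ (k / 2 : ℝ) * (1 + x ^ 2 / c) ^ (k / 2 + r : ℝ) := by
        rw [Real.mul_rpow hc.le hp.le, Real.rpow_add hp, mul_assoc]

theorem integrable_one_add_sq_div_rpow (hc : 0 < c) (hr : r < -(1 / 2)) :
    Integrable fun x : ℝ ↦ (1 + x ^ 2 / c) ^ r := by
  have h := (integrable_rpow_neg_one_add_norm_sq (E := ℝ) (μ := volume) (r := -2 * r)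
    (by simp; linarith)).comp_div (Real.sqrt_pos.2 hc).ne'
  refine h.congr (ae_of_all _ fun x ↦ ?_)
  simp only [Real.norm_eq_abs, sq_abs, div_pow, Real.sq_sqrt hc.le]
  ring_nf

theorem integrable_pow_mul_one_add_sq_div_rpow (hc : 0 < c) (hr : k + 1 + 2 * r < 0) :
    Integrable fun x : ℝ ↦ x ^ k * (1 + x ^ 2 / c) ^ r :=
  ((integrable_one_add_sq_div_rpow hc (by linarith : k / 2 + r < -(1 / 2))).const_mul
      (c ^ (k / 2 : ℝ))).mono'
    ((continuous_pow k).mul (continuous_one_add_sq_div_rpow hc r)).aestronglyMeasurable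
    (ae_of_all _ (abs_pow_mul_one_add_sq_div_rpow_le hc r k))

theorem not_integrable_pow_mul_one_add_sq_div_rpow (hc : 0 < c) (hr0 : r ≤ 0)
    (hr : 0 ≤ k + 1 + 2 * r) : ¬ Integrable fun x : ℝ ↦ x ^ k * (1 + x ^ 2 / c) ^ r := by
  intro h
  have hbound {x : ℝ} (hx : 1 < x) :
      (1 + 1 / c) ^ r * x ^ (k + 2 * r) ≤ x ^ k * (1 + x ^ 2 / c) ^ r := by
    have hx0 : 0 < x := one_pos.trans hx
    have hle : 1 + x ^ 2 / c ≤ (1 + 1 / c) * x ^ 2 := by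
      have : 1 < x ^ 2 := one_lt_pow₀ hx two_ne_zero
      linarith [show (1 + 1 / c) * x ^ 2 = x ^ 2 + x ^ 2 / c by ring]
    calc (1 + 1 / c) ^ r * x ^ (k + 2 * r) = x ^ k * ((1 + 1 / c) * x ^ 2) ^ r := by
          rw [Real.rpow_add hx0, Real.rpow_natCast, Real.mul_rpow (by positivity) (by positivity),
            Real.rpow_mul hx0.le, Real.rpow_two]
          ring
      _ ≤ x ^ k * (1 + x ^ 2 / c) ^ r := mul_le_mul_of_nonneg_left
          (Real.rpow_le_rpow_of_nonpos (by positivity) hle hr0) (by positivity)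
  have hIoi : IntegrableOn (fun x : ℝ ↦ (1 + 1 / c) ^ r * x ^ (k + 2 * r)) (Set.Ioi 1) := by
    refine (h.integrableOn (s := Set.Ioi 1)).mono' (by fun_prop) ?_
    filter_upwards [ae_restrict_mem measurableSet_Ioi] with x hx
    have : 0 < x := one_pos.trans hx
    rw [Real.norm_of_nonneg (by positivity)]
    exact hbound hx
  have hunit : IsUnit ((1 + 1 / c) ^ r) := (by positivity : (1 + 1 / c) ^ r ≠ 0).isUnit
  have hlt := (integrableOn_Ioi_rpow_iff one_pos).1 ((integrable_const_mul_iff hunit _).1 hIoi)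
  linarith

theorem tendsto_pow_mul_one_add_sq_div_rpow_cocompact (hc : 0 < c) (hr : k + 2 * r < 0) :
    Tendsto (fun x : ℝ ↦ x ^ k * (1 + x ^ 2 / c) ^ r) (cocompact ℝ) (𝓝 0) := by
  have hsq : Tendsto (fun x : ℝ ↦ 1 + x ^ 2 / c) (cocompact ℝ) atTop := by
    refine tendsto_atTop_add_const_left _ _ (Tendsto.atTop_div_const hc ?_)
    simpa [Function.comp_def] using
      (tendsto_pow_atTop (α := ℝ) two_ne_zero).comp (tendsto_norm_cocompact_atTop (E := ℝ))
  have hneg : 0 < -(k / 2 + r) := by linarith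
  refine squeeze_zero_norm (abs_pow_mul_one_add_sq_div_rpow_le hc r k) ?_
  simpa only [neg_neg, mul_zero, Function.comp_def] using
    ((tendsto_rpow_neg_atTop hneg).comp hsq).const_mul (c ^ (k / 2 : ℝ))

theorem hasDerivAt_pow_succ_mul_one_add_sq_div_rpow (hc : 0 < c) (r : ℝ) (k : ℕ) (x : ℝ) :
    HasDerivAt (fun x ↦ x ^ (k + 1) * (1 + x ^ 2 / c) ^ (r + 1))
      ((k + 1) * (x ^ k * (1 + x ^ 2 / c) ^ r)
        + (k + 3 + 2 * r) / c * (x ^ (k + 2) * (1 + x ^ 2 / c) ^ r)) x := by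
  have hp : 0 < 1 + x ^ 2 / c := by positivity
  have hbase : HasDerivAt (fun x : ℝ ↦ 1 + x ^ 2 / c) (2 * x / c) x := by
    simpa using ((hasDerivAt_pow 2 x).div_const c).const_add 1
  refine ((hasDerivAt_pow (k + 1) x).mul
    (hbase.rpow_const (p := r + 1) (.inl hp.ne'))).congr_deriv ?_
  rw [add_sub_cancel_right, Real.rpow_add_one hp.ne']
  push_cast
  field_simp
  ring

theorem integral_pow_add_two_mul_one_add_sq_div_rpow (hc : 0 < c) (hr : k + 3 + 2 * r < 0) :
    ∫ x : ℝ, x ^ (k + 2) * (1 + x ^ 2 / c) ^ r =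
      (k + 1) * c / -(k + 3 + 2 * r) * ∫ x : ℝ, x ^ k * (1 + x ^ 2 / c) ^ r := by
  have hint : Integrable fun x : ℝ ↦ x ^ k * (1 + x ^ 2 / c) ^ r :=
    integrable_pow_mul_one_add_sq_div_rpow hc (by linarith)
  have hint2 : Integrable fun x : ℝ ↦ x ^ (k + 2) * (1 + x ^ 2 / c) ^ r :=
    integrable_pow_mul_one_add_sq_div_rpow hc (by push_cast; linarith)
  have hlim := tendsto_pow_mul_one_add_sq_div_rpow_cocompact hc (k := k + 1) (r := r + 1)
    (by push_cast; linarith)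
  have hzero := integral_of_hasDerivAt_of_tendsto
    (hasDerivAt_pow_succ_mul_one_add_sq_div_rpow hc r k)
    ((hint.const_mul _).add (hint2.const_mul _)) (hlim.mono_left atBot_le_cocompact)
    (hlim.mono_left atTop_le_cocompact)
  rw [integral_add (hint.const_mul _) (hint2.const_mul _), integral_const_mul, integral_const_mul,
    sub_zero, div_mul_eq_mul_div, ← eq_neg_iff_add_eq_zero, ← neg_div, eq_div_iff hc.ne'] at hzero
  rw [div_mul_eq_mul_div, eq_div_iff (neg_pos.2 hr).ne']
  linarith

theorem integral_pow_mul_one_add_sq_div_rpow_of_odd (hk : Odd k) (c r : ℝ) :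
    ∫ x : ℝ, x ^ k * (1 + x ^ 2 / c) ^ r = 0 := by
  have h := integral_neg_eq_self (fun x : ℝ ↦ x ^ k * (1 + x ^ 2 / c) ^ r) volume
  simp only [neg_sq, hk.neg_pow, neg_mul, integral_neg] at h
  linarith

end StudentKernel

section StudentMoments

variable {φ : ℝ≥0} {ν : ℝ}

/-- The normalizing constant of the Student density `studentTPDF φ ν`. -/
noncomputable def studentTConst (φ : ℝ≥0) (ν : ℝ) : ℝ :=
  Real.Gamma ((ν + 1) / 2) / (Real.Gamma (ν / 2) * √(ν * Real.pi * φ))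

theorem studentTPDF_eq_const_mul (φ : ℝ≥0) (ν x : ℝ) :
    studentTPDF φ ν x = studentTConst φ ν * (1 + x ^ 2 / (ν * φ)) ^ (-((ν + 1) / 2)) :=
  rfl

theorem studentTConst_pos (hφ : 0 < φ) (hν : 0 < ν) : 0 < studentTConst φ ν := by
  have : 0 < Real.Gamma ((ν + 1) / 2) := Real.Gamma_pos_of_pos (by linarith)
  have : 0 < Real.Gamma (ν / 2) := Real.Gamma_pos_of_pos (by linarith)
  unfold studentTConst
  positivity

theorem studentTPDF_nonneg (hν : 0 < ν) (φ : ℝ≥0) (x : ℝ) : 0 ≤ studentTPDF φ ν x := by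
  have : 0 < Real.Gamma ((ν + 1) / 2) := Real.Gamma_pos_of_pos (by linarith)
  have : 0 < Real.Gamma (ν / 2) := Real.Gamma_pos_of_pos (by linarith)
  unfold studentTPDF
  positivity

theorem measurable_studentTPDF (φ : ℝ≥0) (ν : ℝ) : Measurable (studentTPDF φ ν) := by
  unfold studentTPDF
  fun_prop

theorem integral_studentT {E : Type*} [NormedAddCommGroup E] [NormedSpace ℝ E] (hν : 0 < ν)
    (φ : ℝ≥0) (f : ℝ → E) : ∫ x, f x ∂studentT φ ν = ∫ x, studentTPDF φ ν x • f x := by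
  rw [studentT, integral_withDensity_eq_integral_toReal_smul
    (measurable_studentTPDF φ ν).ennreal_ofReal (ae_of_all _ fun _ ↦ ENNReal.ofReal_lt_top)]
  simp only [ENNReal.toReal_ofReal (studentTPDF_nonneg hν φ _)]

theorem integrable_studentT_iff {E : Type*} [NormedAddCommGroup E] [NormedSpace ℝ E]
    (hν : 0 < ν) (φ : ℝ≥0) (f : ℝ → E) :
    Integrable f (studentT φ ν) ↔ Integrable fun x ↦ studentTPDF φ ν x • f x := by
  rw [studentT, integrable_withDensity_iff_integrable_smul'
    (measurable_studentTPDF φ ν).ennreal_ofReal (ae_of_all _ fun _ ↦ ENNReal.ofReal_lt_top)]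
  simp only [ENNReal.toReal_ofReal (studentTPDF_nonneg hν φ _)]

theorem integrable_pow_studentT_iff (hφ : 0 < φ) (hν : 0 < ν) (k : ℕ) :
    Integrable (fun x ↦ x ^ k) (studentT φ ν) ↔ k < ν := by
  have hc : 0 < ν * φ := by positivity
  have hkernel : Integrable (fun x : ℝ ↦ x ^ k * (1 + x ^ 2 / (ν * φ)) ^ (-((ν + 1) / 2))) ↔
      k < ν := by
    refine ⟨fun h ↦ ?_, fun h ↦ integrable_pow_mul_one_add_sq_div_rpow hc (by linarith)⟩
    contrapose! h
    exact not_integrable_pow_mul_one_add_sq_div_rpow hc (by linarith) (by linarith)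
  simp only [integrable_studentT_iff hν, smul_eq_mul, studentTPDF_eq_const_mul, mul_assoc]
  rw [integrable_const_mul_iff (studentTConst_pos hφ hν).ne'.isUnit]
  simpa only [mul_comm] using hkernel

theorem integral_pow_studentT (hν : 0 < ν) (φ : ℝ≥0) (k : ℕ) : ∫ x, x ^ k ∂studentT φ ν =
    studentTConst φ ν * ∫ x, x ^ k * (1 + x ^ 2 / (ν * φ)) ^ (-((ν + 1) / 2)) := by
  simp only [integral_studentT hν, smul_eq_mul, studentTPDF_eq_const_mul, ← integral_const_mul]
  congr with x
  ring

theorem integral_pow_studentT_of_odd (hν : 0 < ν) (φ : ℝ≥0) {k : ℕ} (hk : Odd k) :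
    ∫ x, x ^ k ∂studentT φ ν = 0 := by
  rw [integral_pow_studentT hν, integral_pow_mul_one_add_sq_div_rpow_of_odd hk, mul_zero]

theorem integral_pow_add_two_studentT (hφ : 0 < φ) {k : ℕ} (hk : k + 2 < ν) :
    ∫ x, x ^ (k + 2) ∂studentT φ ν =
      (k + 1) * (ν * φ) / (ν - 2 - k) * ∫ x, x ^ k ∂studentT φ ν := by
  have hν : 0 < ν := by linarith [k.cast_nonneg (α := ℝ)]
  have hden : -(k + 3 + 2 * -((ν + 1) / 2)) = ν - 2 - k := by ring
  rw [integral_pow_studentT hν, integral_pow_studentT hν,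
    integral_pow_add_two_mul_one_add_sq_div_rpow (by positivity) (by linarith), hden,
    mul_left_comm]

variable {Ω : Type*} [MeasurableSpace Ω] {P : Measure Ω} {X : Ω → ℝ}

theorem integral_pow_of_studentT (hX : HasLaw X (studentT φ ν) P) (k : ℕ) :
    ∫ ω, X ω ^ k ∂P = ∫ x, x ^ k ∂studentT φ ν :=
  hX.integral_comp (f := fun x ↦ x ^ k) (by fun_prop)

theorem integral_of_studentT (hX : HasLaw X (studentT φ ν) P) (hν : 0 < ν) : P[X] = 0 := by
  have h := integral_pow_of_studentT hX 1
  rw [integral_pow_studentT_of_odd hν φ odd_one] at h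
  simpa only [pow_one] using h

variable [IsProbabilityMeasure P]

theorem memLp_iff_lt_of_studentT (hX : HasLaw X (studentT φ ν) P) (hφ : 0 < φ) (hν : 0 < ν)
    (k : ℕ) : MemLp X k P ↔ k < ν := by
  rw [← integrable_pow_iff_memLp hX.aemeasurable.aestronglyMeasurable,
    ← integrable_pow_studentT_iff hφ hν, ← hX.map_eq,
    integrable_map_measure (by fun_prop) hX.aemeasurable]
  rfl

theorem variance_of_studentT (hX : HasLaw X (studentT φ ν) P) (hφ : 0 < φ) (hν : 2 < ν) :
    Var[X; P] = ν * φ / (ν - 2) := by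
  have hmass : ∫ x, x ^ 0 ∂studentT φ ν = 1 :=
    (integral_pow_of_studentT hX 0).symm.trans (by simp)
  rw [variance_of_integral_eq_zero hX.aemeasurable (integral_of_studentT hX (by linarith)),
    integral_pow_of_studentT hX, integral_pow_add_two_studentT hφ (k := 0) (by simpa), hmass]
  simp

theorem kurtosis_of_studentT (hX : HasLaw X (studentT φ ν) P) (hφ : 0 < φ) (hν : 4 < ν) :
    kurtosis X P = 3 * ((ν - 2) / (ν - 4)) := by
  have hmean := integral_of_studentT hX (by linarith)
  have hvar := variance_of_studentT hX hφ (by linarith)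
  have hsq : ∫ x, x ^ 2 ∂studentT φ ν = ν * φ / (ν - 2) := by
    rw [← hvar, variance_of_integral_eq_zero hX.aemeasurable hmean, integral_pow_of_studentT hX]
  have hfourth : centralMoment X 4 P = 3 * (ν * φ) / (ν - 4) * (ν * φ / (ν - 2)) := by
    simp only [centralMoment, hmean, Pi.pow_apply, Pi.sub_apply, sub_zero]
    rw [integral_pow_of_studentT hX,
      integral_pow_add_two_studentT hφ (k := 2) (by norm_num; linarith), hsq]
    norm_num [sub_sub]
  have : 0 < ν - 2 := by linarith
  have : 0 < ν - 4 := by linarith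
  rw [kurtosis_eq_centralMoment_div hX.aemeasurable, hfourth,
    centralMoment_two_eq_variance hX.aemeasurable, hvar]
  field_simp

end StudentMoments

section StudentLimit

theorem gamma_add_half_le {x : ℝ} (hx : 0 < x) :
    Real.Gamma (x + 1 / 2) ≤ Real.Gamma x * √x := by
  have h := Real.Gamma_mul_add_mul_le_rpow_Gamma_mul_rpow_Gamma hx (by linarith : 0 < x + 1)
    (by norm_num : (0 : ℝ) < 1 / 2) (by norm_num : (0 : ℝ) < 1 / 2) (by norm_num)
  rw [Real.Gamma_add_one hx.ne', ← Real.sqrt_eq_rpow, ← Real.sqrt_eq_rpow, Real.sqrt_mul hx.le,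
    mul_left_comm, Real.mul_self_sqrt (Real.Gamma_pos_of_pos hx).le, mul_comm √x] at h
  convert h using 2
  ring

theorem gamma_mul_self_le {x : ℝ} (hx : 0 < x) :
    Real.Gamma x * x ≤ Real.Gamma (x + 1 / 2) * √(x + 1 / 2) := by
  have h := gamma_add_half_le (by linarith : 0 < x + 1 / 2)
  rwa [add_assoc, add_halves, Real.Gamma_add_one hx.ne', mul_comm x] at h

theorem gamma_add_half_div_le_one {x : ℝ} (hx : 0 < x) :
    Real.Gamma (x + 1 / 2) / (Real.Gamma x * √x) ≤ 1 := by
  have : 0 < Real.Gamma x := Real.Gamma_pos_of_pos hx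
  exact div_le_one_of_le₀ (gamma_add_half_le hx) (by positivity)

theorem sqrt_div_add_half_le_gamma_add_half_div {x : ℝ} (hx : 0 < x) :
    √(x / (x + 1 / 2)) ≤ Real.Gamma (x + 1 / 2) / (Real.Gamma x * √x) := by
  have : 0 < Real.Gamma x := Real.Gamma_pos_of_pos hx
  rw [Real.sqrt_div hx.le, div_le_div_iff₀ (by positivity) (by positivity), mul_left_comm,
    Real.mul_self_sqrt hx.le]
  exact gamma_mul_self_le hx

theorem tendsto_gamma_add_half_div :
    Tendsto (fun x ↦ Real.Gamma (x + 1 / 2) / (Real.Gamma x * √x)) atTop (𝓝 1) := by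
  have hratio : Tendsto (fun x : ℝ ↦ x / (x + 1 / 2)) atTop (𝓝 1) := by
    have h : Tendsto (fun x : ℝ ↦ 1 - 1 / 2 / (x + 1 / 2)) atTop (𝓝 (1 - 0)) :=
      tendsto_const_nhds.sub
        (Tendsto.const_div_atTop (tendsto_atTop_add_const_right _ _ tendsto_id) _)
    rw [sub_zero] at h
    refine h.congr' ?_
    filter_upwards [eventually_gt_atTop 0] with x hx
    rw [one_sub_div (by positivity), add_sub_cancel_right]
  have hsqrt := hratio.sqrt
  rw [Real.sqrt_one] at hsqrt
  refine tendsto_of_tendsto_of_tendsto_of_le_of_le' hsqrt tendsto_const_nhds ?_ ?_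
  · filter_upwards [eventually_gt_atTop 0] with x hx
    exact sqrt_div_add_half_le_gamma_add_half_div hx
  · filter_upwards [eventually_gt_atTop 0] with x hx
    exact gamma_add_half_div_le_one hx

variable {φ : ℝ≥0} {ν : ℝ}

theorem studentTConst_eq (hν : 0 < ν) (φ : ℝ≥0) :
    studentTConst φ ν = Real.Gamma (ν / 2 + 1 / 2) / (Real.Gamma (ν / 2) * √(ν / 2)) *
      (√(2 * Real.pi * φ))⁻¹ := by
  have h : ν * Real.pi * φ = ν / 2 * (2 * Real.pi * φ) := by ring
  rw [studentTConst, h, Real.sqrt_mul (by positivity), add_div, ← mul_assoc, div_mul_eq_div_div,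
    div_eq_mul_inv _ (√(2 * Real.pi * φ))]

theorem studentTConst_le (hν : 0 < ν) (φ : ℝ≥0) :
    studentTConst φ ν ≤ (√(2 * Real.pi * φ))⁻¹ := by
  rw [studentTConst_eq hν]
  exact mul_le_of_le_one_left (by positivity) (gamma_add_half_div_le_one (half_pos hν))

theorem tendsto_studentTConst (φ : ℝ≥0) :
    Tendsto (studentTConst φ) atTop (𝓝 (√(2 * Real.pi * φ))⁻¹) := by
  have h := (tendsto_gamma_add_half_div.comp
    (tendsto_id.atTop_div_const (two_pos (α := ℝ)))).mul_const (√(2 * Real.pi * φ))⁻¹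
  rw [one_mul] at h
  refine h.congr' ?_
  filter_upwards [eventually_gt_atTop 0] with ν hν using (studentTConst_eq hν φ).symm

theorem tendsto_one_add_div_rpow_neg_half_add_one (t : ℝ) :
    Tendsto (fun ν : ℝ ↦ (1 + t / ν) ^ (-((ν + 1) / 2))) atTop (𝓝 (Real.exp (-(t / 2)))) := by
  have hbase : Tendsto (fun ν : ℝ ↦ 1 + t / ν) atTop (𝓝 1) := by
    simpa using (tendsto_const_nhds (x := t)).div_atTop tendsto_id |>.const_add 1
  have h := ((Real.tendsto_one_add_div_rpow_exp t).mul hbase).rpow_const (p := -(1 / 2))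
    (.inl (by positivity))
  rw [mul_one, ← Real.exp_mul, mul_neg, mul_one_div] at h
  refine h.congr' ?_
  filter_upwards [hbase.eventually_const_lt one_pos] with ν hν
  rw [← Real.rpow_add_one hν.ne', ← Real.rpow_mul hν.le]
  ring_nf

theorem tendsto_studentTPDF (φ : ℝ≥0) (x : ℝ) :
    Tendsto (fun ν ↦ studentTPDF φ ν x) atTop (𝓝 (gaussianPDFReal 0 φ x)) := by
  have hexp : gaussianPDFReal 0 φ x =
      (√(2 * Real.pi * φ))⁻¹ * Real.exp (-(x ^ 2 / φ / 2)) := by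
    rw [gaussianPDFReal, sub_zero, neg_div, div_div, mul_comm (φ : ℝ)]
  rw [hexp]
  refine ((tendsto_studentTConst φ).mul
    (tendsto_one_add_div_rpow_neg_half_add_one (x ^ 2 / φ))).congr fun ν ↦ ?_
  rw [studentTPDF_eq_const_mul, div_div, mul_comm (φ : ℝ)]

theorem studentTPDF_le (hν : 1 ≤ ν) (φ : ℝ≥0) (x : ℝ) :
    studentTPDF φ ν x ≤ (√(2 * Real.pi * φ))⁻¹ * (1 + x ^ 2 / (2 * φ)) ^ (-1 : ℝ) := by
  have hν0 : 0 < ν := by linarith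
  have hbernoulli : 1 + x ^ 2 / (2 * φ) ≤ (1 + x ^ 2 / (ν * φ)) ^ ((ν + 1) / 2) := by
    have hu : 0 ≤ x ^ 2 / (ν * φ) := by positivity
    calc 1 + x ^ 2 / (2 * φ) = 1 + ν / 2 * (x ^ 2 / (ν * φ)) := by
          rw [div_mul_div_comm, mul_left_comm, mul_div_mul_left _ _ hν0.ne']
      _ ≤ 1 + (ν + 1) / 2 * (x ^ 2 / (ν * φ)) := by gcongr; linarith
      _ ≤ (1 + x ^ 2 / (ν * φ)) ^ ((ν + 1) / 2) :=
          one_add_mul_self_le_rpow_one_add (by linarith) (by linarith)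
  rw [studentTPDF_eq_const_mul]
  refine mul_le_mul (studentTConst_le hν0 φ) ?_ (by positivity) (by positivity)
  rw [Real.rpow_neg (by positivity), Real.rpow_neg_one]
  exact inv_anti₀ (by positivity) hbernoulli

theorem tendsto_integral_studentT {E : Type*} [NormedAddCommGroup E] [NormedSpace ℝ E]
    (hφ : 0 < φ) {f : ℝ → E} (hf : AEStronglyMeasurable f) {C : ℝ} (hC : ∀ x, ‖f x‖ ≤ C) :
    Tendsto (fun ν ↦ ∫ x, f x ∂studentT φ ν) atTop (𝓝 (∫ x, f x ∂gaussianReal 0 φ)) := by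
  rw [integral_gaussianReal_eq_integral_smul hφ.ne']
  have hdom : Tendsto (fun ν ↦ ∫ x, studentTPDF φ ν x • f x) atTop
      (𝓝 (∫ x, gaussianPDFReal 0 φ x • f x)) := by
    refine tendsto_integral_filter_of_dominated_convergence
      (fun x ↦ (√(2 * Real.pi * φ))⁻¹ * (1 + x ^ 2 / (2 * φ)) ^ (-1 : ℝ) * C)
      (.of_forall fun ν ↦ (measurable_studentTPDF φ ν).aestronglyMeasurable.smul hf) ?_
      (((integrable_one_add_sq_div_rpow (by positivity) (by norm_num)).const_mul _).mul_const _)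
      (ae_of_all _ fun x ↦ (tendsto_studentTPDF φ x).smul_const _)
    filter_upwards [eventually_ge_atTop 1] with ν hν
    refine ae_of_all _ fun x ↦ ?_
    rw [norm_smul, Real.norm_of_nonneg (studentTPDF_nonneg (by linarith) φ x)]
    exact mul_le_mul (studentTPDF_le hν φ x) (hC x) (norm_nonneg _) (by positivity)
  refine hdom.congr' ?_
  filter_upwards [eventually_gt_atTop 0] with ν hν using (integral_studentT hν φ f).symm

end StudentLimit

section SampleKurtosis

variable {Ω : Type*} [MeasurableSpace Ω] {P : Measure Ω} [IsProbabilityMeasure P]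
  {y : ℕ → Ω → ℝ}

theorem tendstoInDistribution_sqrt_mul_sampleKurtosis_gaussianReal_sub_three {μ : ℝ} {v : ℝ≥0}
    (hv : v ≠ 0) (hy : ∀ i, HasLaw (y i) (gaussianReal μ v) P) (hindep : iIndepFun y P) :
    TendstoInDistribution (fun (n : ℕ) ω ↦ √(n : ℝ) * (sampleKurtosis n (y · ω) - 3)) atTop
      (id : ℝ → ℝ) (fun _ ↦ P) (gaussianReal 0 24) := by
  have hident (i : ℕ) : IdentDistrib (y i) (y 0) P P := (hy i).identDistrib (hy 0)
  have hmem : MemLp (y 0) 8 P :=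
    (memLp_map_measure_iff (g := id) (by fun_prop) (hy 0).aemeasurable).1
      ((hy 0).map_eq ▸ memLp_id_gaussianReal 8)
  have hvar : Var[y 0; P] = v := by rw [(hy 0).variance_eq, variance_id_gaussianReal]
  rw [← kurtosis_of_gaussianReal (hy 0) hv]
  refine tendstoInDistribution_sqrt_mul_sampleKurtosis_sub hmem (by simpa [hvar]) ?_ hindep hident
  rw [variance_kurtosisInfluence_of_gaussianReal (hy 0) hv]
  simpa using HasLaw.id (μ := gaussianReal 0 24)

variable {φ : ℝ≥0} {ν : ℝ}

theorem variance_ne_zero_of_studentT {X : Ω → ℝ} (hX : HasLaw X (studentT φ ν) P) (hφ : 0 < φ)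
    (hν : 2 < ν) : Var[X; P] ≠ 0 := by
  have : 0 < ν - 2 := by linarith
  rw [variance_of_studentT hX hφ hν]
  positivity

theorem tendsto_sampleKurtosis_studentT_ae (hφ : 0 < φ) (hν : 4 < ν)
    (hy : ∀ i, HasLaw (y i) (studentT φ ν) P) (hindep : iIndepFun y P) :
    ∀ᵐ ω ∂P, Tendsto (fun n ↦ sampleKurtosis n (y · ω)) atTop
      (𝓝 (3 * ((ν - 2) / (ν - 4)))) := by
  rw [← kurtosis_of_studentT (hy 0) hφ hν]
  exact tendsto_sampleKurtosis_ae
    (mod_cast (memLp_iff_lt_of_studentT (hy 0) hφ (by linarith) 4).2 (mod_cast hν))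
    (variance_ne_zero_of_studentT (hy 0) hφ (by linarith))
    (fun _ _ hij ↦ hindep.indepFun hij) fun i ↦ (hy i).identDistrib (hy 0)

theorem tendsto_sqrt_mul_sampleKurtosis_studentT_sub_three_ae (hφ : 0 < φ) (hν : 2 < ν)
    (hy : ∀ i, HasLaw (y i) (studentT φ ν) P) (hindep : iIndepFun y P) :
    ∀ᵐ ω ∂P, Tendsto (fun n : ℕ ↦ √(n : ℝ) * (sampleKurtosis n (y · ω) - 3)) atTop atTop := by
  have hmem (k : ℕ) : MemLp (y 0) k P ↔ k < ν :=
    memLp_iff_lt_of_studentT (hy 0) hφ (by linarith) k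
  refine tendsto_sqrt_mul_sampleKurtosis_sub_atTop_ae (mod_cast (hmem 2).2 (mod_cast hν))
    (variance_ne_zero_of_studentT (hy 0) hφ hν) (fun h4 ↦ ?_)
    (fun _ _ hij ↦ hindep.indepFun hij) fun i ↦ (hy i).identDistrib (hy 0)
  have hν4 : 4 < ν := mod_cast (hmem 4).1 (mod_cast h4)
  have hratio : 1 < (ν - 2) / (ν - 4) := (one_lt_div (by linarith)).2 (by linarith)
  rw [kurtosis_of_studentT (hy 0) hφ hν4]
  linarith

end SampleKurtosis

theorem theorem1 {Ω : Type*} [MeasurableSpace Ω] (P : Measure Ω) [IsProbabilityMeasure P]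
    (y : ℕ → Ω → ℝ) (hindep : iIndepFun y P) :
    -- Gaussian data
    (∀ φN : ℝ≥0, 0 < φN → (∀ τ, HasLaw (y τ) (gaussianReal 0 φN) P) →
      TendstoInDistribution
        (fun (n : ℕ) (ω : Ω) ↦ √(n : ℝ) * (sampleKurtosis n (fun τ ↦ y τ ω) - 3))
        atTop (id : ℝ → ℝ) (fun _ ↦ P) (gaussianReal 0 24)) ∧
    -- Student data with finite positive variance
    (∀ (φT : ℝ≥0) (ν : ℝ), 0 < φT → 2 < ν → (∀ τ, HasLaw (y τ) (studentT φT ν) P) →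
      (∀ᵐ ω ∂P, Tendsto
        (fun n : ℕ ↦ √(n : ℝ) * (sampleKurtosis n (fun τ ↦ y τ ω) - 3)) atTop atTop) ∧
      (4 < ν → ∀ᵐ ω ∂P, Tendsto
        (fun n : ℕ ↦ sampleKurtosis n (fun τ ↦ y τ ω)) atTop
        (𝓝 (3 * ((ν - 2) / (ν - 4)))))) ∧
    -- the Gaussian model is the weak limit of the Student model as `ν → ∞`
    (∀ φ : ℝ≥0, 0 < φ → ∀ f : ℝ →ᵇ ℝ,
      Tendsto (fun ν : ℝ ↦ ∫ x, f x ∂(studentT φ ν)) atTop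
        (𝓝 (∫ x, f x ∂(gaussianReal 0 φ)))) := by
  refine ⟨fun φN hφ hy ↦ ?_, fun φT ν hφ hν hy ↦ ⟨?_, fun hν4 ↦ ?_⟩, fun φ hφ f ↦ ?_⟩
  · exact tendstoInDistribution_sqrt_mul_sampleKurtosis_gaussianReal_sub_three hφ.ne' hy hindep
  · exact tendsto_sqrt_mul_sampleKurtosis_studentT_sub_three_ae hφ hν hy hindep
  · exact tendsto_sampleKurtosis_studentT_ae hφ hν4 hy hindep
  · exact tendsto_integral_studentT hφ f.continuous.aestronglyMeasurable f.norm_coe_le_norm
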